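/- Let $\mathcal{A}\neq 0$ be a commutative $\sigma$-finite W*-algebra or a commutative AW*-algebra, and let $\mathcal{E}$ be a Hilbert C*-module over $\mathcal{A}$ of rank $d\in\mathbb{N}$, that is, $\mathcal{E}$ has an orthonormal basis of $d$ elements. Let $G$ be a (finite-dimensional real) Lie group with at least two elements, let $\mu_G$ be a left Haar measure on $G$, and let $\Delta=\{(g,g):g\in G\}$. Let $\{\tau_g\}_{g\in G}$ be a continuous modular frame for $\mathcal{E}$: for each $x\in\mathcal{E}$ the map $G\ni g\mapsto\langle x,\tau_g\rangle\in\mathcal{A}$ is continuous, and there are real $a,b>0$ such that $$a\langle x,x\rangle\le\int_G\langle x,\tau_g\rangle\langle\tau_g,x\rangle\,d\mu_G(g)\le b\langle x,x\rangle\qquad\text{for all }x\in\mathcal{E}.$$ Assume that $\langle\tau_g,\tau_g\rangle=1$ for all $g\in G$. Then $\mu_G(G)<\infty$, $\Delta$ is measurable, $(\mu_G\times\mu_G)((G\times G)\setminus\Delta)>0$, the expression under the square root below is nonnegative, the supremum below is finite, and $$\sup_{g,h\in G,\ g\ne h}\|\langle\tau_g,\tau_h\rangle\|\ \ge\ \gamma:=\left(\frac{1}{(\mu_G\times\mu_G)((G\times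 G)\setminus\Delta)}\left[\frac{\mu_G(G)^2}{d}-(\mu_G\times\mu_G)(\Delta)\right]\right)^{1/2}.$$ If moreover the frame is $\gamma^2$-equiangular, i.e. $\langle\tau_g,\tau_h\rangle\langle\tau_h,\tau_g\rangle=\gamma^2\cdot 1$ for all $g\neq h$ in $G$, then equality holds in this inequality. -/

import Mathlib

open MeasureTheory Set
open scoped Manifold ContDiff

/-- A W*-algebra (or C*-algebra) is `σ`-finite if every set of mutually orthogonal projections
is countable. -/
def IsSigmaFiniteAlgebra (A : Type*) [CStarAlgebra A] : Prop :=
  ∀ S : Set A, (∀ p ∈ S, IsStarProjection p) → S.Pairwise (fun p q => p * q = 0) → S.Countable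

/-- Kaplansky's definition of an AW*-algebra. The order is the usual one on self-adjoint elements,
and the supremum is taken in the set of projections. -/
structure IsAWStarAlgebra (A : Type*) [CStarAlgebra A] [PartialOrder A] [StarOrderedRing A] :
    Prop where
  /-- Every set of mutually orthogonal projections has a supremum. -/
  exists_isLUB : ∀ S : Set {p : A // IsStarProjection p},
    S.Pairwise (fun p q => (p : A) * (q : A) = 0) → ∃ s, IsLUB S s
  /-- Every maximal commutative self-adjoint subalgebra is generated, as a C*-algebra, by its
  projections. -/
  generated_of_maximal : ∀ B : StarSubalgebra ℂ A,
    Maximal (fun C : StarSubalgebra ℂ A => ∀ x ∈ C, ∀ y ∈ C, x * y = y * x) B →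
      (StarAlgebra.adjoin ℂ {p : A | p ∈ B ∧ IsStarProjection p}).topologicalClosure = B

section Frames

/- The inner product `inner A x y` of `CStarModule` is `A`-linear in the second variable. So the
inner product `⟨x, y⟩` that is `A`-linear in the first variable is written `inner A y x` here. -/

variable (A : Type*) {E : Type*} [CommCStarAlgebra A] [PartialOrder A] [StarOrderedRing A]
  [NormedAddCommGroup E] [NormedSpace ℂ E] [Module A E] [CStarModule A E]

/-- `e 0, …, e (d - 1)` is an orthonormal basis: `⟨e j, e k⟩ = δ_jk`, and
`x = ∑ j, ⟨x, e j⟩ e j` for all `x`. -/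
def IsModularOrthonormalBasis {d : ℕ} (e : Fin d → E) : Prop :=
  (∀ j k, inner A (e j) (e k) = if j = k then 1 else 0) ∧
    ∀ x : E, x = ∑ j, (inner A (e j) x : A) • e j

variable (E) in
/-- The Hilbert C*-module `E` over the commutative C*-algebra `A` has rank `d`. -/
def HasModularRank (d : ℕ) : Prop :=
  ∃ e : Fin d → E, IsModularOrthonormalBasis A e

variable {G : Type*}

/-- `⟨τ_g, τ_g⟩ = 1` for all `g`. -/
def IsUnitInnerProduct (τ : G → E) : Prop :=
  ∀ g, inner A (τ g) (τ g) = (1 : A)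

/-- The integrals `∫ ⟨x, τ_g⟩⟨τ_g, x⟩ dμ(g)` are Bochner integrals in `A`; that they exist is part
of the definition. -/
structure IsContinuousModularFrame [TopologicalSpace G] [MeasurableSpace G] (μ : Measure G)
    (τ : G → E) : Prop where
  continuous_inner : ∀ x : E, Continuous fun g => (inner A (τ g) x : A)
  integrable : ∀ x : E,
    Integrable (fun g => (inner A (τ g) x : A) * (inner A x (τ g) : A)) μ
  bounds : ∃ a b : ℝ, 0 < a ∧ 0 < b ∧ ∀ x : E,
    a • (inner A x x : A) ≤ ∫ g, (inner A (τ g) x : A) * (inner A x (τ g) : A) ∂μ ∧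
    ∫ g, (inner A (τ g) x : A) * (inner A x (τ g) : A) ∂μ ≤ b • (inner A x x : A)

/-- The set of all `‖⟨τ_g, τ_h⟩‖` with `g ≠ h`. -/
def crossCorrelations (τ : G → E) : Set ℝ :=
  {r | ∃ g h : G, g ≠ h ∧ r = ‖(inner A (τ h) (τ g) : A)‖}

/-- The frame correlation `sup_{g ≠ h} ‖⟨τ_g, τ_h⟩‖`. -/
noncomputable def frameCorrelation (τ : G → E) : ℝ :=
  sSup (crossCorrelations A τ)

/-- The family is `c`-equiangular for the positive element `c` of `A`:
`⟨τ_g, τ_h⟩⟨τ_h, τ_g⟩ = c` for all `g ≠ h`. -/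
def IsEquiangular (c : A) (τ : G → E) : Prop :=
  0 ≤ c ∧ ∀ g h : G, g ≠ h → (inner A (τ h) (τ g) : A) * (inner A (τ g) (τ h) : A) = c

end Frames

/-- `(μ(G)² / d - (μ × μ)(Δ)) / (μ × μ)((G × G) ∖ Δ)` with `Δ` the diagonal of `G × G`. -/
noncomputable def welchRadicand {G : Type*} [MeasurableSpace G] (μ : Measure G) (d : ℕ) : ℝ :=
  1 / (μ.prod μ).real (diagonal G)ᶜ *
    ((μ.real univ) ^ 2 / (d : ℝ) - (μ.prod μ).real (diagonal G))

/-- The bound `γ`. -/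
noncomputable def welchBound {G : Type*} [MeasurableSpace G] (μ : Measure G) (d : ℕ) : ℝ :=
  √(welchRadicand μ d)

/-!
A nonzero commutative C*-algebra `A` has a character `φ`, and a character never increases the norm.
Evaluating the coefficients of `τ_g` in an orthonormal basis `e` at `φ` gives unit vectors
`w g : Fin d → ℂ` with `φ ⟨τ_g, τ_h⟩ = ∑ j, w g j * conj (w h j)` (`character_inner_eq_sum`), so a
lower bound for the correlation of these vectors is one for the correlation of the modular frame.

For unit vectors in `ℂ^d` the bound is the Welch inequality
(`sq_measureReal_div_card_le_integral_gram`): with the frame operator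
`S j k = ∫ w g j * conj (w g k)`, the integral of `|⟨w g, w h⟩|²` over `G × G` is
`∑ j k, |S j k|²`, which is at least `(tr S)² / d = μ(G)² / d`. On the diagonal the integrand is
at most `1`, and off the diagonal it is at most the squared correlation.

The measure is finite because, by Parseval's identity, the frame integrands of the vectors `e j` add
up to the constant `1` (`IsContinuousModularFrame.isFiniteMeasure`). Hence `G` is compact and second
countable, and its diagonal is measurable. The diagonal has measure `μ {1} * μ(G)`, so that the
radicand is nonnegative if `d * μ {1} ≤ μ(G)`. This is clear if `μ {1} = 0`; otherwise `G` is
finite, and it has at least `d` elements since by the lower frame bound the vectors `w g` span `ℂ^d`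
(`IsContinuousModularFrame.rank_le_card`).
-/

/-! ### The continuous Welch inequality in `ℂ^d` -/

section Welch

variable {G ι : Type*} [MeasurableSpace G] {μ : Measure G} [Fintype ι] {w : G → ι → ℂ}

theorem norm_apply_le_one_of_sum_sq {w : ι → ℂ} (hw : ∑ j, ‖w j‖ ^ 2 = 1) (j : ι) : ‖w j‖ ≤ 1 := by
  have h : ‖w j‖ ^ 2 ≤ 1 := hw ▸
    Finset.single_le_sum (f := fun j => ‖w j‖ ^ 2) (fun i _ => by positivity) (Finset.mem_univ j)
  exact (sq_le_one_iff₀ (norm_nonneg _)).1 h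

/-- Each entry of the Gram kernel has modulus at most one, by the Cauchy–Schwarz inequality. -/
theorem norm_sum_mul_conj_le_one {v w : ι → ℂ} (hv : ∑ j, ‖v j‖ ^ 2 = 1)
    (hw : ∑ j, ‖w j‖ ^ 2 = 1) : ‖∑ j, v j * starRingEnd ℂ (w j)‖ ≤ 1 := by
  have h1 : ‖∑ j, v j * starRingEnd ℂ (w j)‖ ≤ ∑ j, ‖v j‖ * ‖w j‖ :=
    (norm_sum_le _ _).trans_eq (by simp)
  have h2 := Finset.sum_mul_sq_le_sq_mul_sq Finset.univ (fun j => ‖v j‖) (fun j => ‖w j‖)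
  rw [hv, hw, one_mul] at h2
  exact h1.trans ((sq_le_one_iff₀ (by positivity)).1 h2)

theorem integrable_mul_conj [IsFiniteMeasure μ] (hm : ∀ j, AEStronglyMeasurable (fun g => w g j) μ)
    (hw : ∀ g, ∑ j, ‖w g j‖ ^ 2 = 1) (j k : ι) :
    Integrable (fun g => w g j * starRingEnd ℂ (w g k)) μ := by
  refine Integrable.of_bound
    ((hm j).mul (Complex.continuous_conj.comp_aestronglyMeasurable (hm k))) 1 ?_
  filter_upwards with g
  rw [norm_mul, RCLike.norm_conj]
  exact mul_le_one₀ (norm_apply_le_one_of_sum_sq (hw g) j) (norm_nonneg _)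
    (norm_apply_le_one_of_sum_sq (hw g) k)

/-- The squared modulus of the Gram kernel is a sum of products of a function of the first variable
and one of the second. -/
theorem ofReal_norm_sq_sum_mul_conj (v w : ι → ℂ) :
    ((‖∑ j, v j * starRingEnd ℂ (w j)‖ ^ 2 : ℝ) : ℂ) =
      ∑ j, ∑ k, (v j * starRingEnd ℂ (v k)) * starRingEnd ℂ (w j * starRingEnd ℂ (w k)) := by
  push_cast
  rw [← Complex.mul_conj', map_sum, Finset.sum_mul_sum]
  refine Finset.sum_congr rfl fun j _ => Finset.sum_congr rfl fun k _ => ?_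
  simp only [map_mul, Complex.conj_conj]
  ring

theorem integrable_gram_summand [IsFiniteMeasure μ]
    (hm : ∀ j, AEStronglyMeasurable (fun g => w g j) μ) (hw : ∀ g, ∑ j, ‖w g j‖ ^ 2 = 1)
    (j k : ι) :
    Integrable (fun p : G × G => (w p.1 j * starRingEnd ℂ (w p.1 k)) *
      starRingEnd ℂ (w p.2 j * starRingEnd ℂ (w p.2 k))) (μ.prod μ) := by
  have h := integrable_mul_conj hm hw j k
  exact h.mul_prod (((LinearIsometryEquiv.integrable_comp_iff Complex.conjLIE).2 h))

/-- The integral of the squared Gram kernel is the squared Hilbert–Schmidt norm of the frame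
operator. -/
theorem integral_norm_sq_gram [IsFiniteMeasure μ]
    (hm : ∀ j, AEStronglyMeasurable (fun g => w g j) μ) (hw : ∀ g, ∑ j, ‖w g j‖ ^ 2 = 1) :
    ∫ p : G × G, ‖∑ j, w p.1 j * starRingEnd ℂ (w p.2 j)‖ ^ 2 ∂(μ.prod μ) =
      ∑ j, ∑ k, ‖∫ g, w g j * starRingEnd ℂ (w g k) ∂μ‖ ^ 2 := by
  apply Complex.ofReal_injective
  rw [← integral_complex_ofReal]
  simp_rw [ofReal_norm_sq_sum_mul_conj]
  rw [integral_finsetSum _ fun j _ => integrable_finsetSum _ fun k _ =>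
    integrable_gram_summand hm hw j k]
  push_cast
  refine Finset.sum_congr rfl fun j _ => ?_
  rw [integral_finsetSum _ fun k _ => integrable_gram_summand hm hw j k]
  refine Finset.sum_congr rfl fun k _ => ?_
  rw [integral_prod_mul (fun g => w g j * starRingEnd ℂ (w g k))
    (fun g => starRingEnd ℂ (w g j * starRingEnd ℂ (w g k))), integral_conj, Complex.mul_conj']

/-- The continuous first-order Welch inequality: the squared Hilbert–Schmidt norm of the frame
operator is at least the square of its trace `μ(G)` divided by the dimension. -/
theorem sq_measureReal_div_card_le_integral_gram [IsFiniteMeasure μ]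
    (hm : ∀ j, AEStronglyMeasurable (fun g => w g j) μ) (hw : ∀ g, ∑ j, ‖w g j‖ ^ 2 = 1) :
    μ.real univ ^ 2 / Fintype.card ι ≤
      ∫ p : G × G, ‖∑ j, w p.1 j * starRingEnd ℂ (w p.2 j)‖ ^ 2 ∂(μ.prod μ) := by
  rw [integral_norm_sq_gram hm hw]
  have htrace : (μ.real univ : ℂ) = ∑ j, ∫ g, w g j * starRingEnd ℂ (w g j) ∂μ := by
    rw [← integral_finsetSum _ fun j _ => integrable_mul_conj hm hw j j]
    have : ∀ g, ∑ j, w g j * starRingEnd ℂ (w g j) = 1 := fun g => by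
      simp_rw [Complex.mul_conj']
      exact_mod_cast hw g
    simp [this]
  have hle : μ.real univ ≤ ∑ j, ‖∫ g, w g j * starRingEnd ℂ (w g j) ∂μ‖ := by
    calc μ.real univ = ‖(μ.real univ : ℂ)‖ := by simp [abs_of_nonneg measureReal_nonneg]
      _ ≤ _ := htrace ▸ norm_sum_le _ _
  refine div_le_of_le_mul₀ (by positivity) (by positivity) ?_
  calc μ.real univ ^ 2 ≤ (∑ j, ‖∫ g, w g j * starRingEnd ℂ (w g j) ∂μ‖) ^ 2 := by gcongr
    _ ≤ Fintype.card ι * ∑ j, ‖∫ g, w g j * starRingEnd ℂ (w g j) ∂μ‖ ^ 2 :=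
      sq_sum_le_card_mul_sum_sq
    _ ≤ Fintype.card ι * ∑ j, ∑ k, ‖∫ g, w g j * starRingEnd ℂ (w g k) ∂μ‖ ^ 2 := by
      gcongr with j
      exact Finset.single_le_sum (f := fun k => ‖∫ g, w g j * starRingEnd ℂ (w g k) ∂μ‖ ^ 2)
        (fun i _ => by positivity) (Finset.mem_univ j)
    _ = _ := mul_comm _ _

/-- The Welch inequality for vectors of correlation at most `K`: the squared Gram kernel is at most
`1` on the diagonal and at most `K ^ 2` off it. -/
theorem sq_measureReal_div_card_le [IsFiniteMeasure μ] (hΔ : MeasurableSet (diagonal G))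
    (hm : ∀ j, AEStronglyMeasurable (fun g => w g j) μ) (hw : ∀ g, ∑ j, ‖w g j‖ ^ 2 = 1)
    {K : ℝ} (hK : ∀ g h, g ≠ h → ‖∑ j, w g j * starRingEnd ℂ (w h j)‖ ≤ K) :
    μ.real univ ^ 2 / Fintype.card ι ≤
      (μ.prod μ).real (diagonal G) + K ^ 2 * (μ.prod μ).real (diagonal G)ᶜ := by
  refine (sq_measureReal_div_card_le_integral_gram hm hw).trans ?_
  have h1 : Integrable ((diagonal G).indicator fun _ => (1 : ℝ)) (μ.prod μ) :=
    (integrable_const _).indicator hΔ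
  have h2 : Integrable ((diagonal G)ᶜ.indicator fun _ => K ^ 2) (μ.prod μ) :=
    (integrable_const _).indicator hΔ.compl
  calc _ ≤ ∫ p : G × G, ((diagonal G).indicator (fun _ => (1 : ℝ)) p +
          (diagonal G)ᶜ.indicator (fun _ => K ^ 2) p) ∂(μ.prod μ) := by
        refine integral_mono_of_nonneg (.of_forall fun p => by positivity) (h1.add h2)
          (.of_forall fun p => ?_)
        by_cases hp : p ∈ diagonal G
        · simpa [hp] using norm_sum_mul_conj_le_one (hw p.1) (hw p.2)
        · simpa [hp] using pow_le_pow_left₀ (norm_nonneg _) (hK p.1 p.2 hp) 2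
    _ = _ := by
        rw [integral_add h1 h2, integral_indicator_const _ hΔ, integral_indicator_const _ hΔ.compl]
        simp [mul_comm]

end Welch

/-! ### Mass of the diagonal of a group -/

section Group

variable {G : Type*} [Group G] [MeasurableSpace G] [MeasurableMul G] {μ : Measure G}
  [μ.IsMulLeftInvariant]

theorem measure_singleton_eq_measure_singleton_one (g : G) : μ {g} = μ {1} := by
  simpa using (measure_preimage_mul μ g {g}).symm

theorem prod_diagonal_eq [SFinite μ] (hΔ : MeasurableSet (diagonal G)) :
    (μ.prod μ) (diagonal G) = μ {1} * μ univ := by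
  rw [Measure.prod_apply hΔ]
  have : ∀ g : G, Prod.mk g ⁻¹' diagonal G = {g} := fun g => by ext; simp [eq_comm]
  simp [this, measure_singleton_eq_measure_singleton_one]

/-- If the group has at least `d` points whenever it is finite, then `d` times the mass of a point
is at most the total mass. For an infinite group of finite measure points have mass zero. -/
theorem mul_measureReal_singleton_le [MeasurableSingletonClass G] [IsFiniteMeasure μ] {d : ℕ}
    (hd : ∀ [Fintype G], d ≤ Fintype.card G) : d * μ.real {1} ≤ μ.real univ := by
  by_cases h0 : μ {1} = 0
  · simp [Measure.real, h0]
  have hfin : Finite G := by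
    rw [← Set.finite_univ_iff]
    by_contra hinf
    exact measure_ne_top μ univ (Set.Infinite.meas_eq_top hinf
      ⟨μ {1}, h0, fun g _ => (measure_singleton_eq_measure_singleton_one g).ge⟩)
  have := Fintype.ofFinite G
  have hsum : μ.real univ = Fintype.card G * μ.real {1} := by
    rw [← Finset.coe_univ, ← sum_measureReal_singleton]
    simp [Measure.real, measure_singleton_eq_measure_singleton_one]
  rw [hsum]
  gcongr
  exact hd

end Group

/-! ### Frames evaluated at a character -/

section Frames

open scoped ComplexOrder
open WeakDual

theorem norm_character_le {A : Type*} [CommCStarAlgebra A] (φ : characterSpace ℂ A) (a : A) :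
    ‖φ a‖ ≤ ‖a‖ := by
  simpa using NonUnitalStarAlgHom.norm_apply_le φ a

variable {A E G : Type*} [CommCStarAlgebra A] [PartialOrder A]
  [NormedAddCommGroup E] [NormedSpace ℂ E] [Module A E] [CStarModule A E] {d : ℕ} {e : Fin d → E}

/-- Parseval's identity for a modular orthonormal basis. -/
theorem IsModularOrthonormalBasis.inner_eq_sum (he : IsModularOrthonormalBasis A e) (x y : E) :
    (inner A x y : A) = ∑ j, (inner A (e j) y : A) * inner A x (e j) := by
  conv_lhs => rw [he.2 y]
  simp

/-- The vector in `ℂ^d` of the coefficients of `x` with respect to `e`, evaluated at the character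
`φ` of `A`. -/
noncomputable def characterCoeff (φ : characterSpace ℂ A) (e : Fin d → E) (x : E) (j : Fin d) : ℂ :=
  φ (inner A (e j) x)

theorem conj_characterCoeff (φ : characterSpace ℂ A) (x : E) (j : Fin d) :
    starRingEnd ℂ (characterCoeff φ e x j) = φ (inner A x (e j)) := by
  rw [characterCoeff, starRingEnd_apply, ← map_star, CStarModule.star_inner]

theorem character_inner_eq_sum (he : IsModularOrthonormalBasis A e) (φ : characterSpace ℂ A)
    (x y : E) :
    φ (inner A x y) = ∑ j, characterCoeff φ e y j * starRingEnd ℂ (characterCoeff φ e x j) := by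
  rw [he.inner_eq_sum, map_sum]
  simp_rw [map_mul, conj_characterCoeff, characterCoeff]

theorem sum_norm_sq_characterCoeff (he : IsModularOrthonormalBasis A e) (φ : characterSpace ℂ A)
    {x : E} (hx : inner A x x = (1 : A)) : ∑ j, ‖characterCoeff φ e x j‖ ^ 2 = 1 := by
  have h := character_inner_eq_sum he φ x x
  rw [hx, map_one] at h
  simp_rw [Complex.mul_conj'] at h
  exact_mod_cast h.symm

variable [TopologicalSpace G] [MeasurableSpace G] {μ : Measure G} {τ : G → E}

theorem IsContinuousModularFrame.continuous_characterCoeff (hτ : IsContinuousModularFrame A μ τ)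
    (φ : characterSpace ℂ A) (j : Fin d) : Continuous fun g => characterCoeff φ e (τ g) j := by
  have h : Continuous fun g => starRingEnd ℂ (φ (inner A (τ g) (e j))) :=
    Complex.continuous_conj.comp ((map_continuous φ).comp (hτ.continuous_inner (e j)))
  refine h.congr fun g => ?_
  rw [← conj_characterCoeff, Complex.conj_conj]

/-- By Parseval's identity the integrands of the basis vectors add up to the constant `1`, which is
therefore integrable. -/
theorem IsContinuousModularFrame.isFiniteMeasure [Nontrivial A]
    (hτ : IsContinuousModularFrame A μ τ) (hunit : IsUnitInnerProduct A τ)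
    (he : IsModularOrthonormalBasis A e) : IsFiniteMeasure μ := by
  have h : Integrable (fun g => ∑ j, (inner A (τ g) (e j) : A) * inner A (e j) (τ g)) μ :=
    integrable_finsetSum _ fun j _ => hτ.integrable (e j)
  have h1 : (fun g => ∑ j, (inner A (τ g) (e j) : A) * inner A (e j) (τ g)) = fun _ => 1 := by
    funext g
    simp_rw [← hunit g, he.inner_eq_sum (τ g) (τ g), mul_comm]
  rw [h1, integrable_const_iff] at h
  exact h.resolve_left one_ne_zero

variable [StarOrderedRing A]

/-- A vector with complex coordinates `c` in the basis `e` that is orthogonal to the whole frame at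
the character `φ` vanishes: this is the lower frame bound evaluated at `φ`. -/
theorem IsContinuousModularFrame.coord_eq_zero (hτ : IsContinuousModularFrame A μ τ)
    (he : IsModularOrthonormalBasis A e) (φ : characterSpace ℂ A) {c : Fin d → ℂ}
    (hc : ∀ g, ∑ j, c j * starRingEnd ℂ (characterCoeff φ e (τ g) j) = 0) : c = 0 := by
  set x : E := ∑ j, c j • e j with hx
  have hcoeff : characterCoeff φ e x = c := by
    funext k
    simp only [characterCoeff, hx, CStarModule.inner_sum_right,
      CStarModule.inner_smul_right_complex, he.1, map_sum, map_smul]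
    simp
  obtain ⟨a, b, ha, -, hab⟩ := hτ.bounds
  have hle : φ (a • (inner A x x : A)) ≤
      φ (∫ g, (inner A (τ g) x : A) * (inner A x (τ g) : A) ∂μ) :=
    OrderHomClass.mono φ (hab x).1
  have hint : φ (∫ g, (inner A (τ g) x : A) * (inner A x (τ g) : A) ∂μ) = 0 := by
    have := (ContinuousLinearMap.integral_comp_comm (CharacterSpace.toCLM φ) (hτ.integrable x))
    refine this.symm.trans ?_
    simp [character_inner_eq_sum he φ (τ _) x, hcoeff, hc]
  have hself : φ (a • (inner A x x : A)) = ((a * ∑ j, ‖c j‖ ^ 2 : ℝ) : ℂ) := by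
    rw [← Complex.coe_smul, map_smul, character_inner_eq_sum he φ x x, hcoeff]
    simp_rw [Complex.mul_conj']
    push_cast
    rfl
  rw [hint, hself] at hle
  have hle' : a * ∑ j, ‖c j‖ ^ 2 ≤ 0 := by exact_mod_cast hle
  have hzero : ∑ j, ‖c j‖ ^ 2 = 0 :=
    le_antisymm (nonpos_of_mul_nonpos_right hle' ha) (by positivity)
  funext j
  have := (Finset.sum_eq_zero_iff_of_nonneg fun i _ => by positivity).1 hzero j (Finset.mem_univ j)
  simpa using this

/-- At a character the frame becomes a frame of `ℂ^d`, so that the analysis operator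
`ℂ^d → (G → ℂ)` is injective. -/
theorem IsContinuousModularFrame.rank_le_card [Nontrivial A] [Fintype G]
    (hτ : IsContinuousModularFrame A μ τ) (he : IsModularOrthonormalBasis A e) :
    d ≤ Fintype.card G := by
  obtain ⟨φ⟩ := (inferInstance : Nonempty (characterSpace ℂ A))
  let f : (Fin d → ℂ) →ₗ[ℂ] (G → ℂ) :=
    Matrix.mulVecLin (Matrix.of fun g j => starRingEnd ℂ (characterCoeff φ e (τ g) j))
  have hf : Function.Injective f := by
    rw [← LinearMap.ker_eq_bot, LinearMap.ker_eq_bot']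
    intro c hc
    refine hτ.coord_eq_zero he φ fun g => ?_
    simpa [f, Matrix.mulVec, dotProduct, mul_comm] using congrFun hc g
  simpa using LinearMap.finrank_le_finrank_of_injective hf

end Frames

/-! ### Frame correlation -/

section Correlation

variable {A E G : Type*} [CommCStarAlgebra A] [PartialOrder A]
  [NormedAddCommGroup E] [NormedSpace ℂ E] [Module A E] [CStarModule A E] {τ : G → E}

theorem frameCorrelation_nonneg : 0 ≤ frameCorrelation A τ :=
  Real.sSup_nonneg (by rintro _ ⟨g, h, -, rfl⟩; exact norm_nonneg _)

theorem IsEquiangular.frameCorrelation_eq [Nontrivial A] [Nontrivial G] {γ : ℝ} (hγ : 0 ≤ γ)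
    (h : IsEquiangular A (algebraMap ℝ A (γ ^ 2)) τ) : frameCorrelation A τ = γ := by
  have key : ∀ g k : G, g ≠ k → ‖(inner A (τ k) (τ g) : A)‖ = γ := fun g k hgk => by
    have h1 := congrArg norm (h.2 g k hgk)
    rw [← CStarModule.star_inner (τ k) (τ g), CStarRing.norm_self_mul_star, norm_algebraMap',
      Real.norm_of_nonneg (by positivity), ← sq] at h1
    exact (pow_left_inj₀ (norm_nonneg _) hγ two_ne_zero).1 h1
  obtain ⟨g, k, hgk⟩ := exists_pair_ne G
  have hset : crossCorrelations A τ = {γ} := by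
    ext r
    constructor
    · rintro ⟨g, k, hgk, rfl⟩
      exact key g k hgk
    · rintro rfl
      exact ⟨g, k, hgk, (key g k hgk).symm⟩
  rw [frameCorrelation, hset, csSup_singleton]

variable [StarOrderedRing A]

theorem IsUnitInnerProduct.norm_inner_le_one (hunit : IsUnitInnerProduct A τ) (g h : G) :
    ‖(inner A (τ h) (τ g) : A)‖ ≤ 1 := by
  have hn : ∀ g, ‖τ g‖ ≤ 1 := fun g => by
    rw [CStarModule.norm_eq_sqrt_norm_inner_self (A := A), hunit g]
    nontriviality A
    simp
  exact (CStarModule.norm_inner_le E).trans (mul_le_one₀ (hn h) (norm_nonneg _) (hn g))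

theorem IsUnitInnerProduct.bddAbove_crossCorrelations (hunit : IsUnitInnerProduct A τ) :
    BddAbove (crossCorrelations A τ) :=
  ⟨1, by rintro _ ⟨g, h, -, rfl⟩; exact hunit.norm_inner_le_one g h⟩

end Correlation

/-! ### Lie groups of finite Haar measure -/

/-- A Lie group is not assumed to be second countable, but one of finite Haar measure is compact and
covered by finitely many charts. This makes the diagonal measurable for the product `σ`-algebra. -/
theorem secondCountableTopology_of_isFiniteMeasure_haar
    {V : Type*} [NormedAddCommGroup V] [NormedSpace ℝ V] [FiniteDimensional ℝ V]
    {H : Type*} [TopologicalSpace H] (I : ModelWithCorners ℝ V H)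
    {G : Type*} [Group G] [TopologicalSpace G] [T2Space G] [ChartedSpace H G] [LieGroup I ∞ G]
    [MeasurableSpace G] [BorelSpace G] (μ : Measure G) [μ.IsHaarMeasure] [IsFiniteMeasure μ] :
    SecondCountableTopology G := by
  have := topologicalGroup_of_lieGroup I ∞ (G := G)
  have := Manifold.locallyCompact_of_finiteDimensional (M := G) I
  have : CompactSpace G := by
    by_contra hG
    have : NoncompactSpace G := not_compactSpace_iff.1 hG
    exact measure_ne_top μ univ (measure_univ_of_isMulLeftInvariant μ)
  have := I.secondCountableTopology
  exact ChartedSpace.secondCountable_of_sigmaCompact H G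

theorem mainTheorem12
    {A : Type*} [CommCStarAlgebra A] [PartialOrder A] [StarOrderedRing A] [Nontrivial A]
    (hA : (WStarAlgebra A ∧ IsSigmaFiniteAlgebra A) ∨ IsAWStarAlgebra A)
    {E : Type*} [NormedAddCommGroup E] [NormedSpace ℂ E] [CompleteSpace E]
    [Module A E] [CStarModule A E]
    (d : ℕ) (hd : HasModularRank A E d)
    {V : Type*} [NormedAddCommGroup V] [NormedSpace ℝ V] [FiniteDimensional ℝ V]
    {H : Type*} [TopologicalSpace H] (I : ModelWithCorners ℝ V H) [I.Boundaryless]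
    {G : Type*} [Group G] [TopologicalSpace G] [T2Space G] [ChartedSpace H G] [LieGroup I ∞ G]
    [Nontrivial G] [MeasurableSpace G] [BorelSpace G]
    (μ : Measure G) [μ.IsHaarMeasure]
    (τ : G → E) (hframe : IsContinuousModularFrame A μ τ) (hunit : IsUnitInnerProduct A τ) :
    -- the quantities in the inequality are well defined
    (μ univ < ⊤ ∧ MeasurableSet (diagonal G) ∧ 0 < (μ.prod μ) (diagonal G)ᶜ ∧
      0 ≤ welchRadicand μ d ∧ BddAbove (crossCorrelations A τ)) ∧
    welchBound μ d ≤ frameCorrelation A τ ∧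
    (IsEquiangular A (algebraMap ℝ A (welchBound μ d ^ 2)) τ →
      frameCorrelation A τ = welchBound μ d) := by
  obtain ⟨e, he⟩ := hd
  have := hframe.isFiniteMeasure hunit he
  have := topologicalGroup_of_lieGroup I ∞ (G := G)
  have := secondCountableTopology_of_isFiniteMeasure_haar I μ
  have hΔ : MeasurableSet (diagonal G) := measurableSet_diagonal
  have hpos : 0 < (μ.prod μ) (diagonal G)ᶜ := by
    obtain ⟨g, h, hgh⟩ := exists_pair_ne G
    exact isClosed_diagonal.isOpen_compl.measure_pos _ ⟨(g, h), hgh⟩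
  have hposR : 0 < (μ.prod μ).real (diagonal G)ᶜ :=
    ENNReal.toReal_pos hpos.ne' (measure_ne_top _ _)
  -- If `d = 0`, then `E = 0`, contradicting `⟨τ_g, τ_g⟩ = 1`.
  have hd0 : 0 < (d : ℝ) := by
    rcases Nat.eq_zero_or_pos d with rfl | h
    · have h1 : (1 : A) = 0 := by
        rw [← hunit 1, he.inner_eq_sum]
        simp
      exact absurd h1 one_ne_zero
    · exact_mod_cast h
  have hrad : 0 ≤ welchRadicand μ d := by
    have h := mul_measureReal_singleton_le (μ := μ) (d := d) (hframe.rank_le_card he)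
    refine mul_nonneg (by positivity) (sub_nonneg.2 ?_)
    rw [Measure.real, prod_diagonal_eq hΔ, ENNReal.toReal_mul, le_div_iff₀ hd0]
    change μ.real {1} * μ.real univ * d ≤ _
    nlinarith [measureReal_nonneg (μ := μ) (s := univ)]
  have hbdd := hunit.bddAbove_crossCorrelations
  refine ⟨⟨measure_lt_top _ _, hΔ, hpos, hrad, hbdd⟩, ?_,
    fun h => h.frameCorrelation_eq (Real.sqrt_nonneg _)⟩
  -- A single character gives the bound, because `|φ ⟨τ_g, τ_h⟩| ≤ ‖⟨τ_g, τ_h⟩‖`.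
  obtain ⟨φ⟩ := (inferInstance : Nonempty (WeakDual.characterSpace ℂ A))
  have hwelch := sq_measureReal_div_card_le (μ := μ) (K := frameCorrelation A τ)
    (w := fun g => characterCoeff φ e (τ g)) hΔ
    (fun j => (hframe.continuous_characterCoeff φ j).aestronglyMeasurable)
    (fun g => sum_norm_sq_characterCoeff he φ (hunit g)) fun g h hgh => by
      rw [← character_inner_eq_sum he]
      exact (norm_character_le φ _).trans (le_csSup hbdd ⟨g, h, hgh, rfl⟩)
  rw [Fintype.card_fin] at hwelch
  refine Real.sqrt_le_iff.2 ⟨frameCorrelation_nonneg, ?_⟩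
  rw [welchRadicand, one_div, inv_mul_le_iff₀ hposR]
  linarith
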